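/- Let $n\ge 1$, let $W=(w_{ij})$ be an $n\times n$ row-stochastic real matrix, and let $\mathcal G$ be the directed graph on $\mathcal V=\{1,\dots,n\}$ with a link from $j$ to $i$ if and only if $w_{ij}>0$. Assume that $\mathcal G$ is strongly connected. Let $\theta\in(0,1)$ (the common stubbornness of all agents in the Friedkin–Johnsen model with weight matrix $W$) and $\omega\in(0,1)$ (the weight of a link added by an external influencer, agent $0$). For $\mathcal S\subseteq\mathcal V$ put $D_{\mathcal S}=\sum_{j\in\mathcal S}\mathbf e_j\mathbf e_j^\top$, and let $\bar{\mathcal Y}$ be the Markov chain with states $0'$, $1,\dots,n$, $1',\dots,n'$, in which $0',1',\dots,n'$ are absorbing and, for $i,j\in\mathcal V$, the transition probability from $i$ to $0'$ is $\omega(1-\theta)$ if $i\in\mathcal S$ and $0$ otherwise, from $i$ to $j$ it is $\big[(I-\omega D_{\mathcal S})(1-\theta)W\big]_{ij}$, and from $i$ to $i'$ it is $\theta$. Let $\pi_0(\mathcal S)$ be the probability that $\bar{\mathcal Y}$, started from the uniform distribution on $\{0',1,\dots,n\}$, is absorbed in $0'$. For $\vartheta\in[0,1)$ and $i\in\mathcal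 V$ let $$f(i;\vartheta,\omega)=\frac1n\mathbf 1^\top\big(I-(1-\vartheta)(I-\omega\,\mathbf e_i\mathbf e_i^\top)W\big)^{-1}\mathbf 1 .$$ Assume that $f(\cdot\,;0,\omega)$ has a unique minimizer $i_*$ on $\mathcal V$, and that $\theta$ is small enough that $f(i;\theta,\omega)-f(i_*;\theta,\omega)>0$ for all $i\ne i_*$. For $i,j\in\mathcal V$ let $\tau_{ji}=\min\{t>0: Y_t=i\}$, where $(Y_t)_{t\ge0}$ is the Markov chain on $\mathcal V$ with transition matrix $W$ and $Y_0=j$. Then all expectations $\mathbb E[\tau_{ji}]$ are finite, and the problem $$\text{maximize } \pi_0(\mathcal S)\quad\text{over } \mathcal S\subseteq\mathcal V \text{ with } |\mathcal S|\le 1$$ is equivalent to the problem $$\text{minimize}\quad \frac1n\sum_{j\ne i}\mathbb E[\tau_{ji}]+\frac{1-\omega}{\omega}\,\mathbb E[\tau_{ii}]\quad\text{over } i\in\mathcal V,$$ in the sense that a set $\mathcal S$ is a solution of the first problem if and only if $\mathcal S=\{i\}$ for a solution $i$ of the second. -/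

import Mathlib

open MeasureTheory ProbabilityTheory
open scoped ENNReal unitInterval

noncomputable section

namespace SocialPower

/-! ### Finite homogeneous Markov chains -/

/-- Singletons are measurable in a disjoint union of two spaces with measurable singletons. -/
instance instMeasurableSingletonClassSum {α β : Type*} [MeasurableSpace α] [MeasurableSpace β]
    [MeasurableSingletonClass α] [MeasurableSingletonClass β] :
    MeasurableSingletonClass (α ⊕ β) where
  measurableSet_singleton x := by
    rcases x with a | b
    · rw [← Set.image_singleton]
      exact (measurableSet_singleton a).inl_image
    · rw [← Set.image_singleton]
      exact (measurableSet_singleton b).inr_image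

section Chain

variable {α : Type*} [Fintype α] [DecidableEq α]

/-- The `x`-th row of a row-stochastic matrix, as a probability distribution. -/
def rowPMF (T : Matrix.rowStochastic ℝ α) (x : α) : PMF α :=
  PMF.ofFintype (fun y => ENNReal.ofReal (T.1 x y)) (by
    rw [← ENNReal.ofReal_sum_of_nonneg (fun y _ => T.2.1 x y),
      Matrix.sum_row_of_mem_rowStochastic T.2 x, ENNReal.ofReal_one])

variable [MeasurableSpace α] [MeasurableSingletonClass α]

/-- The one-step transition kernel of the chain with transition matrix `T`. -/
def stepKernel (T : Matrix.rowStochastic ℝ α) : Kernel α α :=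
  Kernel.ofFunOfCountable fun x => (rowPMF T x).toMeasure

instance (T : Matrix.rowStochastic ℝ α) : IsMarkovKernel (stepKernel T) where
  isProbabilityMeasure x := by
    change IsProbabilityMeasure (rowPMF T x).toMeasure
    infer_instance

/-- The conditional law of the state at time `t + 1` given the states at times `0, …, t`:
it depends on the state at time `t` only, through the matrix `T`. -/
def historyKernel (T : Matrix.rowStochastic ℝ α) (t : ℕ) :
    Kernel (Finset.Iic t → α) α :=
  (stepKernel T).comap (fun y => y ⟨t, Finset.mem_Iic.2 le_rfl⟩) (by fun_prop)

instance (T : Matrix.rowStochastic ℝ α) (t : ℕ) : IsMarkovKernel (historyKernel T t) := by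
  unfold historyKernel
  infer_instance

/-- The law, on the space of trajectories `ℕ → α`, of the homogeneous Markov chain with
transition matrix `T` and initial distribution `ν`. -/
def chainLaw (T : Matrix.rowStochastic ℝ α) (ν : Measure α) : Measure (ℕ → α) :=
  Kernel.trajMeasure (X := fun _ => α) ν (historyKernel T)

end Chain

/-- `min {t > 0 : y t = x}`, with value `∞` if the trajectory `y` is never in `x` at a
positive time. -/
def hitTime {α : Type*} (x : α) (y : ℕ → α) : ℕ∞ :=
  ⨅ t ∈ {t : ℕ | 0 < t ∧ y t = x}, (t : ℕ∞)

/-! ### The Friedkin–Johnsen model and its augmented Markov chains -/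

section Model

variable {n : ℕ}

/-- The graph of the weight matrix `W` has a link from `i` to `j` iff `0 < W j i`; it is strongly
connected if there is a directed path from every node to every node. -/
def StronglyConnected (W : Matrix.rowStochastic ℝ (Fin n)) : Prop :=
  ∀ i j : Fin n, Relation.ReflTransGen (fun k l => 0 < W.1 l k) i j

/-- The diagonal matrix `Θ` of the stubbornness coefficients. -/
def stubMatrix (θ : Fin n → I) : Matrix (Fin n) (Fin n) ℝ :=
  Matrix.diagonal fun i => (θ i : ℝ)

/-- The indicator vector `∑_{j ∈ S} e_j`. -/
def indVec (S : Finset (Fin n)) : Fin n → ℝ := fun i => if i ∈ S then 1 else 0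

/-- The transition matrix of the augmented Markov chain of the model `(W, Θ)`, with transient
states `1, …, n` (left summand) and absorbing states `1', …, n'` (right summand). -/
def augMatrix (W : Matrix.rowStochastic ℝ (Fin n)) (θ : Fin n → I) :
    Matrix (Fin n ⊕ Fin n) (Fin n ⊕ Fin n) ℝ :=
  Matrix.fromBlocks ((1 - stubMatrix θ) * W.1) (stubMatrix θ) 0 1

/-- `H(S) = (I - ω ∑_{j ∈ S} e_j e_jᵀ) (I - Θ) W`. -/
def HMatrix (W : Matrix.rowStochastic ℝ (Fin n)) (θ : Fin n → I) (ω : I)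
    (S : Finset (Fin n)) : Matrix (Fin n) (Fin n) ℝ :=
  (1 - (ω : ℝ) • Matrix.diagonal (indVec S)) * (1 - stubMatrix θ) * W.1

/-- States of the augmented chain in the presence of the influencer: the absorbing state `0'`,
the transient states `1, …, n`, and the absorbing states `1', …, n'`. -/
abbrev InflState (n : ℕ) : Type := Unit ⊕ (Fin n ⊕ Fin n)

/-- The transition matrix `T(S)` of the augmented Markov chain when the influencer has added
links of weight `ω` to the agents in `S`. -/
def inflMatrix (W : Matrix.rowStochastic ℝ (Fin n)) (θ : Fin n → I) (ω : I)
    (S : Finset (Fin n)) : Matrix (InflState n) (InflState n) ℝ :=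
  Matrix.fromBlocks 1 0
    (Matrix.fromRows
      (Matrix.replicateCol Unit
        ((ω : ℝ) • ((1 - stubMatrix θ).mulVec (indVec S)))) 0)
    (Matrix.fromBlocks (HMatrix W θ ω S) (stubMatrix θ) 0 1)

lemma one_sub_stub_mul_apply (W : Matrix (Fin n) (Fin n) ℝ) (θ : Fin n → I) (i j : Fin n) :
    ((1 - stubMatrix θ) * W) i j = (1 - (θ i : ℝ)) * W i j := by
  simp [stubMatrix, Matrix.diagonal_mul, sub_mul]

lemma HMatrix_apply (W : Matrix.rowStochastic ℝ (Fin n)) (θ : Fin n → I) (ω : I)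
    (S : Finset (Fin n)) (i j : Fin n) :
    HMatrix W θ ω S i j = (1 - (ω : ℝ) * indVec S i) * ((1 - (θ i : ℝ)) * W.1 i j) := by
  rw [HMatrix, Matrix.mul_assoc, Matrix.sub_mul, Matrix.one_mul, Matrix.smul_mul,
    Matrix.sub_apply, Matrix.smul_apply, Matrix.diagonal_mul, one_sub_stub_mul_apply]
  simp only [smul_eq_mul]
  ring

lemma one_sub_stub_mulVec (θ : Fin n → I) (v : Fin n → ℝ) (i : Fin n) :
    (1 - stubMatrix θ).mulVec v i = (1 - (θ i : ℝ)) * v i := by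
  simp [stubMatrix, Matrix.sub_mulVec, Matrix.mulVec_diagonal, sub_mul]

lemma indVec_mem (S : Finset (Fin n)) (i : Fin n) : 0 ≤ indVec S i ∧ indVec S i ≤ 1 := by
  unfold indVec
  split_ifs <;> norm_num

lemma augMatrix_mem (W : Matrix.rowStochastic ℝ (Fin n)) (θ : Fin n → I) :
    augMatrix W θ ∈ Matrix.rowStochastic ℝ (Fin n ⊕ Fin n) := by
  rw [Matrix.mem_rowStochastic_iff_sum]
  refine ⟨?_, ?_⟩
  · rintro (i | i) (j | j)
    · simp only [augMatrix, Matrix.fromBlocks_apply₁₁, one_sub_stub_mul_apply]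
      exact mul_nonneg (sub_nonneg.2 (θ i).2.2) (W.2.1 i j)
    · simp only [augMatrix, Matrix.fromBlocks_apply₁₂, stubMatrix, Matrix.diagonal_apply]
      split_ifs
      · exact (θ i).2.1
      · exact le_rfl
    · simp [augMatrix]
    · simp only [augMatrix, Matrix.fromBlocks_apply₂₂, Matrix.one_apply]
      split_ifs <;> norm_num
  · rintro (i | i)
    · simp only [augMatrix, Fintype.sum_sum_type, Matrix.fromBlocks_apply₁₁,
        Matrix.fromBlocks_apply₁₂, one_sub_stub_mul_apply, ← Finset.mul_sum,
        Matrix.sum_row_of_mem_rowStochastic W.2 i]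
      simp [stubMatrix, Matrix.diagonal_apply]
    · simp [augMatrix, Fintype.sum_sum_type, Matrix.one_apply]

lemma inflMatrix_mem (W : Matrix.rowStochastic ℝ (Fin n)) (θ : Fin n → I) (ω : I)
    (S : Finset (Fin n)) : inflMatrix W θ ω S ∈ Matrix.rowStochastic ℝ (InflState n) := by
  rw [Matrix.mem_rowStochastic_iff_sum]
  refine ⟨?_, ?_⟩
  · rintro (i | i | i) (j | j | j)
    · simp [inflMatrix]
    · simp [inflMatrix]
    · simp [inflMatrix]
    · simp only [inflMatrix, Matrix.fromBlocks_apply₂₁, Matrix.fromRows_apply_inl,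
        Matrix.replicateCol_apply, Pi.smul_apply, smul_eq_mul, one_sub_stub_mulVec]
      exact mul_nonneg ω.2.1 (mul_nonneg (sub_nonneg.2 (θ i).2.2) (indVec_mem S i).1)
    · simp only [inflMatrix, Matrix.fromBlocks_apply₂₂, Matrix.fromBlocks_apply₁₁, HMatrix_apply]
      refine mul_nonneg (sub_nonneg.2 ?_)
        (mul_nonneg (sub_nonneg.2 (θ i).2.2) (W.2.1 i j))
      exact mul_le_one₀ ω.2.2 (indVec_mem S i).1 (indVec_mem S i).2
    · simp only [inflMatrix, Matrix.fromBlocks_apply₂₂, Matrix.fromBlocks_apply₁₂, stubMatrix,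
        Matrix.diagonal_apply]
      split_ifs
      · exact (θ i).2.1
      · exact le_rfl
    · simp [inflMatrix]
    · simp [inflMatrix]
    · simp only [inflMatrix, Matrix.fromBlocks_apply₂₂, Matrix.one_apply]
      split_ifs <;> norm_num
  · rintro (i | i | i)
    · simp [inflMatrix, Fintype.sum_sum_type]
    · simp only [inflMatrix, Fintype.sum_sum_type, Matrix.fromBlocks_apply₂₁,
        Matrix.fromRows_apply_inl, Matrix.replicateCol_apply, Pi.smul_apply, smul_eq_mul,
        one_sub_stub_mulVec, Matrix.fromBlocks_apply₂₂, Matrix.fromBlocks_apply₁₁,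
        Matrix.fromBlocks_apply₁₂, HMatrix_apply, ← Finset.mul_sum,
        Matrix.sum_row_of_mem_rowStochastic W.2 i]
      simp [stubMatrix, Matrix.diagonal_apply]
      ring
    · simp [inflMatrix, Fintype.sum_sum_type, Matrix.one_apply]

/-- The transition matrix of the augmented chain, as a row-stochastic matrix. -/
def augTransition (W : Matrix.rowStochastic ℝ (Fin n)) (θ : Fin n → I) :
    Matrix.rowStochastic ℝ (Fin n ⊕ Fin n) :=
  ⟨augMatrix W θ, augMatrix_mem W θ⟩

/-- The transition matrix of the augmented chain with influencer, as a row-stochastic matrix. -/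
def inflTransition (W : Matrix.rowStochastic ℝ (Fin n)) (θ : Fin n → I) (ω : I)
    (S : Finset (Fin n)) : Matrix.rowStochastic ℝ (InflState n) :=
  ⟨inflMatrix W θ ω S, inflMatrix_mem W θ ω S⟩

/-- The uniform distribution on the `n + 1` states `0', 1, …, n`. -/
def initLaw (n : ℕ) : Measure (InflState n) :=
  ((n : ℝ≥0∞) + 1)⁻¹ •
    (Measure.dirac (Sum.inl ()) + ∑ i : Fin n, Measure.dirac (Sum.inr (Sum.inl i)))

/-- `π₀(S)`: the probability that the augmented chain with influencer, started uniformly on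
`{0', 1, …, n}`, is absorbed in `0'`. -/
def absorbProb (W : Matrix.rowStochastic ℝ (Fin n)) (θ : Fin n → I) (ω : I)
    (S : Finset (Fin n)) : ℝ≥0∞ :=
  chainLaw (inflTransition W θ ω S) (initLaw n) {y | ∃ t, y t = Sum.inl ()}

/-- `S` solves the problem: maximize `π₀(S)` subject to `|S| ≤ K`. -/
def IsOptimalSet (W : Matrix.rowStochastic ℝ (Fin n)) (θ : Fin n → I) (ω : I) (K : ℕ)
    (S : Finset (Fin n)) : Prop :=
  S.card ≤ K ∧ ∀ S' : Finset (Fin n), S'.card ≤ K → absorbProb W θ ω S' ≤ absorbProb W θ ω S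

/-- `f(S; θ, ω) = (1/n) 1ᵀ (I - (1 - θ)(I - ω ∑_{j ∈ S} e_j e_jᵀ) W)⁻¹ 1`. -/
def objF (W : Matrix.rowStochastic ℝ (Fin n)) (S : Finset (Fin n)) (θ ω : ℝ) : ℝ :=
  (1 / (n : ℝ)) *
    ((1 : Fin n → ℝ) ⬝ᵥ
      ((1 - (1 - θ) • ((1 - ω • Matrix.diagonal (indVec S)) * W.1))⁻¹).mulVec 1)

/-- The stubbornness `θ` is small enough for `W` and `ω`: the minimizer `i₀` of `f(·; 0, ω)` is
unique, and it is also the unique minimizer of `f(·; θ, ω)`. -/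
def SmallStubbornness (W : Matrix.rowStochastic ℝ (Fin n)) (θ ω : ℝ) : Prop :=
  ∃ i₀ : Fin n, (∀ j, j ≠ i₀ → objF W {i₀} 0 ω < objF W {j} 0 ω) ∧
    ∀ i, i ≠ i₀ → 0 < objF W {i} θ ω - objF W {i₀} θ ω

/-- `E[τ_ji]`: the expected first positive time at which the augmented chain of the model without
influencer and without stubbornness, started at `j`, is at `i`. -/
def expHitTime (W : Matrix.rowStochastic ℝ (Fin n)) (j i : Fin n) : ℝ≥0∞ :=
  ∫⁻ y, (hitTime (Sum.inl i) y : ℝ≥0∞)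
    ∂(chainLaw (augTransition W fun _ => 0) (Measure.dirac (Sum.inl j)))

/-- The cost `(1/n) ∑_{j ≠ i} E[τ_ji] + ((1 - ω)/ω) E[τ_ii]`. -/
def hitCost (W : Matrix.rowStochastic ℝ (Fin n)) (ω : ℝ) (i : Fin n) : ℝ≥0∞ :=
  (n : ℝ≥0∞)⁻¹ * ∑ j ∈ Finset.univ.erase i, expHitTime W j i +
    ENNReal.ofReal ((1 - ω) / ω) * expHitTime W i i

end Model

end SocialPower

end

/-!
Both problems are governed by the expected lifetime `(1 - A)⁻¹ *ᵥ 1` of a walk on the agents that is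
killed from time to time. In the influenced chain the walk is killed with probability `θ` at every
step, and with an additional probability `ω (1 - θ)` at the agents of `S`; among the ways of being
killed, the absorption in some `i'` has probability `θ` times the expected lifetime. Hence
`1 - π₀(S)` is a positive multiple of `f(S; θ, ω)`, and maximizing `π₀` amounts to minimizing
`f(·; θ, ω)`, where the empty set is never optimal since a link strictly shortens some lifetime.

For `θ = 0` the walk is killed only when leaving `i`, with probability `ω`. Its lifetime splits
into the time needed to reach `i`, a geometric number of excursions from `i`, and the last step, so
`f(i; 0, ω)` is the hitting-time cost of `i` plus one. The uniqueness of the minimizers at `0` and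
at `θ` and their equality identify the two problems.
-/

noncomputable section

namespace SocialPower

open Filter Matrix Topology

section Transient

variable {α : Type*} [Fintype α]

/-- A *transient* substochastic matrix: from every state, a path of positive entries leads to a row
of sum less than one. These are the transition matrices, restricted to the living states, of the
finite chains that are killed almost surely. -/
structure IsTransient (A : Matrix α α ℝ) : Prop where
  nonneg : ∀ i j, 0 ≤ A i j
  mulVec_one_le : A *ᵥ 1 ≤ 1
  exists_leak : ∀ i, ∃ k, Relation.ReflTransGen (fun a b => 0 < A a b) i k ∧ (A *ᵥ 1) k < 1

namespace IsTransient

variable {A B : Matrix α α ℝ}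

/-- A negative minimum of `x` would propagate along the positive entries of `A`, up to a row of
sum less than one, where it is impossible. -/
lemma nonneg_of_mulVec_le (hA : IsTransient A) {x : α → ℝ} (hx : A *ᵥ x ≤ x) : 0 ≤ x := by
  intro i
  obtain ⟨j, -, hj⟩ := Finset.exists_min_image Finset.univ x ⟨i, Finset.mem_univ i⟩
  have hmin : ∀ k, 0 ≤ x k - x j := fun k => sub_nonneg.2 (hj k (Finset.mem_univ k))
  suffices 0 ≤ x j from this.trans (sub_nonneg.1 (hmin i))
  by_contra! hneg
  have hterm : ∀ a b, 0 ≤ A a b * (x b - x j) := fun a b => mul_nonneg (hA.nonneg a b) (hmin b)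
  have hdefect : ∀ a, x a = x j → ∑ b, A a b * (x b - x j) ≤ x j * (1 - (A *ᵥ 1) a) := by
    intro a ha
    calc ∑ b, A a b * (x b - x j) = (A *ᵥ x) a - x j * (A *ᵥ 1) a := by
          simp only [mulVec, dotProduct, Pi.one_apply, mul_one, mul_sub, Finset.sum_sub_distrib,
            ← Finset.sum_mul, mul_comm (x j)]
      _ ≤ x j * (1 - (A *ᵥ 1) a) := by linarith [hx a]
  have hclosed : ∀ a b, x a = x j → 0 < A a b → x b = x j := by
    intro a b ha hab
    have hsum : ∑ b, A a b * (x b - x j) ≤ 0 := (hdefect a ha).trans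
      (mul_nonpos_of_nonpos_of_nonneg hneg.le (sub_nonneg.2 (hA.mulVec_one_le a)))
    have hzero := (Finset.sum_eq_zero_iff_of_nonneg fun b _ => hterm a b).1
      (hsum.antisymm (Finset.sum_nonneg fun b _ => hterm a b)) b (Finset.mem_univ b)
    exact sub_eq_zero.1 ((mul_eq_zero.1 hzero).resolve_left hab.ne')
  obtain ⟨k, hjk, hk⟩ := hA.exists_leak j
  have hxk : x k = x j := by
    clear hk
    induction hjk with
    | refl => rfl
    | tail _ hbc ih => exact hclosed _ _ ih hbc
  exact (Finset.sum_nonneg fun b _ => hterm k b).not_gt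
    ((hdefect k hxk).trans_lt (mul_neg_of_neg_of_pos hneg (sub_pos.2 hk)))

variable [DecidableEq α]

lemma isUnit_det_one_sub (hA : IsTransient A) : IsUnit (1 - A).det := by
  rw [isUnit_iff_ne_zero]
  intro hdet
  obtain ⟨v, hv, hker⟩ := exists_mulVec_eq_zero_iff.2 hdet
  have hfix : A *ᵥ v = v := by
    rw [sub_mulVec, one_mulVec, sub_eq_zero] at hker
    exact hker.symm
  have hle : 0 ≤ v := hA.nonneg_of_mulVec_le hfix.le
  have hge : 0 ≤ -v := hA.nonneg_of_mulVec_le (by rw [mulVec_neg, hfix])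
  exact hv (le_antisymm (neg_nonneg.1 hge) hle)

lemma inv_one_sub_mulVec_eq_iff (hA : IsTransient A) {x b : α → ℝ} :
    (1 - A)⁻¹ *ᵥ b = x ↔ x = b + A *ᵥ x := by
  have hunit := hA.isUnit_det_one_sub
  calc (1 - A)⁻¹ *ᵥ b = x ↔ b = (1 - A) *ᵥ x := by
        constructor
        · rintro rfl
          rw [mulVec_mulVec, mul_nonsing_inv _ hunit, one_mulVec]
        · rintro rfl
          rw [mulVec_mulVec, nonsing_inv_mul _ hunit, one_mulVec]
    _ ↔ x = b + A *ᵥ x := by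
        rw [sub_mulVec, one_mulVec, eq_sub_iff_add_eq, eq_comm]

lemma inv_one_sub_mulVec_nonneg (hA : IsTransient A) {b : α → ℝ} (hb : 0 ≤ b) :
    0 ≤ (1 - A)⁻¹ *ᵥ b := by
  refine hA.nonneg_of_mulVec_le ?_
  conv_rhs => rw [hA.inv_one_sub_mulVec_eq_iff.1 rfl]
  exact le_add_of_nonneg_left hb

lemma pow_nonneg (hA : IsTransient A) (t : ℕ) (i j : α) : 0 ≤ (A ^ t) i j := by
  induction t generalizing j with
  | zero => rw [pow_zero, one_apply]; positivity
  | succ t ih =>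
    rw [pow_succ, mul_apply]
    exact Finset.sum_nonneg fun k _ => mul_nonneg (ih k) (hA.nonneg k j)

lemma pow_mulVec_nonneg (hA : IsTransient A) {b : α → ℝ} (hb : 0 ≤ b) (t : ℕ) :
    0 ≤ A ^ t *ᵥ b := fun i =>
  Finset.sum_nonneg fun j _ => mul_nonneg (hA.pow_nonneg t i j) (hb j)

lemma summable_pow (hA : IsTransient A) : Summable fun t => A ^ t := by
  refine Pi.summable.2 fun i => Pi.summable.2 fun j =>
    summable_of_sum_range_le (c := (1 - A)⁻¹ i j) (fun t => hA.pow_nonneg t i j) fun m => ?_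
  have hgeom : ∑ t ∈ Finset.range m, A ^ t = (1 - A)⁻¹ - A ^ m * (1 - A)⁻¹ := by
    rw [← mul_nonsing_inv_cancel_right (1 - A) (∑ t ∈ Finset.range m, A ^ t)
      hA.isUnit_det_one_sub, geom_sum_mul_neg, sub_mul, one_mul]
  have hcol : 0 ≤ (1 - A)⁻¹.col j := by
    rw [← mulVec_single_one]
    exact hA.inv_one_sub_mulVec_nonneg (Pi.single_nonneg.2 zero_le_one)
  have htail : 0 ≤ (A ^ m * (1 - A)⁻¹) i j := hA.pow_mulVec_nonneg hcol m i
  rw [← Matrix.sum_apply, hgeom, Matrix.sub_apply]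
  exact sub_le_self _ htail

lemma hasSum_pow (hA : IsTransient A) : HasSum (fun t => A ^ t) (1 - A)⁻¹ := by
  rw [inv_eq_left_inv hA.summable_pow.tsum_pow_mul_one_sub]
  exact hA.summable_pow.hasSum

lemma hasSum_pow_mulVec (hA : IsTransient A) (b : α → ℝ) :
    HasSum (fun t => A ^ t *ᵥ b) ((1 - A)⁻¹ *ᵥ b) :=
  hA.hasSum_pow.map (mulVec.addMonoidHomLeft b) (continuous_id.matrix_mulVec continuous_const)

lemma pow_le_pow (hA : IsTransient A) (hB : IsTransient B) (hAB : ∀ i j, A i j ≤ B i j) (t : ℕ)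
    (i j : α) : (A ^ t) i j ≤ (B ^ t) i j := by
  induction t generalizing j with
  | zero => rfl
  | succ t ih =>
    rw [pow_succ, pow_succ, mul_apply, mul_apply]
    exact Finset.sum_le_sum fun k _ =>
      mul_le_mul (ih k) (hAB k j) (hA.nonneg k j) (hB.pow_nonneg t i k)

lemma sum_inv_one_sub_mulVec_one_lt (hA : IsTransient A) (hB : IsTransient B)
    (hAB : ∀ i j, A i j ≤ B i j) {k : α} (hk : (A *ᵥ 1) k < (B *ᵥ 1) k) :
    ∑ i, ((1 - A)⁻¹ *ᵥ 1) i < ∑ i, ((1 - B)⁻¹ *ᵥ 1) i := by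
  have hle : ∀ t i, (A ^ t *ᵥ 1) i ≤ (B ^ t *ᵥ 1) i := fun t i =>
    Finset.sum_le_sum fun j _ =>
      mul_le_mul_of_nonneg_right (hA.pow_le_pow hB hAB t i j) zero_le_one
  have hrow : ∀ i, ((1 - A)⁻¹ *ᵥ 1) i ≤ ((1 - B)⁻¹ *ᵥ 1) i := fun i =>
    hasSum_le (fun t => hle t i) (Pi.hasSum.1 (hA.hasSum_pow_mulVec 1) i)
      (Pi.hasSum.1 (hB.hasSum_pow_mulVec 1) i)
  have hstrict : ((1 - A)⁻¹ *ᵥ 1) k < ((1 - B)⁻¹ *ᵥ 1) k :=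
    hasSum_lt (i := 1) (fun t => hle t k) (by simpa only [pow_one] using hk)
      (Pi.hasSum.1 (hA.hasSum_pow_mulVec 1) k) (Pi.hasSum.1 (hB.hasSum_pow_mulVec 1) k)
  exact Finset.sum_lt_sum (fun i _ => hrow i) ⟨k, Finset.mem_univ k, hstrict⟩

end IsTransient

end Transient

section RowStochastic

variable {α : Type*} [Fintype α] [DecidableEq α] {T : Matrix α α ℝ}

lemma diagonal_mul_mulVec_one (hT : T ∈ rowStochastic ℝ α) (d : α → ℝ) :
    (diagonal d * T) *ᵥ 1 = d := by
  ext a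
  rw [← mulVec_mulVec, one_vecMul_of_mem_rowStochastic hT, mulVec_diagonal, Pi.one_apply, mul_one]

lemma isTransient_diagonal_mul (hT : T ∈ rowStochastic ℝ α) {d : α → ℝ} (hd₀ : 0 ≤ d) (hd₁ : d ≤ 1)
    (hleak : ∀ a, ∃ b, Relation.ReflTransGen (fun i j => 0 < d i * T i j) a b ∧ d b < 1) :
    IsTransient (diagonal d * T) where
  nonneg a b := by
    rw [diagonal_mul]
    exact mul_nonneg (hd₀ a) (hT.1 a b)
  mulVec_one_le := (diagonal_mul_mulVec_one hT d).trans_le hd₁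
  exists_leak := by simpa only [diagonal_mul, diagonal_mul_mulVec_one hT] using hleak

/-- The matrix `T` with the transitions into `x` forbidden: the entries of its `t`-th power are the
taboo probabilities of the chain with transition matrix `T`, that is, the probabilities of the
paths of length `t` avoiding `x` at the times `1, …, t`. -/
def tabooMatrix (T : Matrix α α ℝ) (x : α) : Matrix α α ℝ :=
  T.updateCol x 0

lemma tabooMatrix_nonneg (hT : T ∈ rowStochastic ℝ α) (x a b : α) : 0 ≤ tabooMatrix T x a b := by
  rw [tabooMatrix, updateCol_apply]
  split_ifs
  exacts [le_rfl, hT.1 a b]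

lemma tabooMatrix_mulVec (T : Matrix α α ℝ) (x : α) (v : α → ℝ) :
    tabooMatrix T x *ᵥ v = T *ᵥ Function.update v x 0 := by
  ext a
  refine Finset.sum_congr rfl fun b _ => ?_
  rcases eq_or_ne b x with rfl | hb <;> simp [tabooMatrix, *]

lemma tabooMatrix_mulVec_one (hT : T ∈ rowStochastic ℝ α) (x a : α) :
    (tabooMatrix T x *ᵥ 1) a = 1 - T a x := by
  have hupdate : Function.update (1 : α → ℝ) x 0 = 1 - Pi.single x 1 := by
    ext b
    rcases eq_or_ne b x with rfl | hb <;> simp [*]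
  rw [tabooMatrix_mulVec, hupdate, mulVec_sub, one_vecMul_of_mem_rowStochastic hT,
    mulVec_single_one]
  rfl

lemma exists_pos_of_mem_rowStochastic (hT : T ∈ rowStochastic ℝ α) (a : α) : ∃ b, 0 < T a b := by
  by_contra! hle
  have hsum := sum_row_of_mem_rowStochastic hT a
  exact (Finset.sum_nonpos fun b _ => hle b).not_gt (hsum ▸ one_pos)

lemma isTransient_tabooMatrix (hT : T ∈ rowStochastic ℝ α) {x : α}
    (hreach : ∀ a, Relation.ReflTransGen (fun i j => 0 < T i j) a x) :
    IsTransient (tabooMatrix T x) where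
  nonneg := tabooMatrix_nonneg hT x
  mulVec_one_le a := by
    rw [tabooMatrix_mulVec_one hT]
    exact sub_le_self _ (hT.1 a x)
  exists_leak a := by
    obtain ⟨b, hab⟩ := exists_pos_of_mem_rowStochastic hT a
    simp only [tabooMatrix_mulVec_one hT, sub_lt_self_iff]
    have hax : Relation.TransGen (fun i j => 0 < T i j) a x := .head' hab (hreach b)
    clear hab
    induction hax using Relation.TransGen.head_induction_on with
    | single hax => exact ⟨_, .refl, hax⟩
    | @head a c hac _ ih =>
      rcases eq_or_ne c x with rfl | hcx
      · exact ⟨a, .refl, hac⟩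
      · obtain ⟨k, hck, hkx⟩ := ih
        exact ⟨k, hck.head (by rwa [tabooMatrix, updateCol_ne hcx]), hkx⟩

/-- The vector of the expected first positive times at which the chain with transition matrix `T`
is in `x`, as a function of the initial state. -/
def meanHitTime (T : Matrix α α ℝ) (x : α) : α → ℝ :=
  (1 - tabooMatrix T x)⁻¹ *ᵥ 1

/-- The left-hand side is the expected lifetime of the chain that is killed with probability `ω`
whenever it leaves `x`. Such a chain has to reach `x`, makes a geometric number of excursions from
`x`, `(1 - ω) / ω` on average, and lives one more step. -/
lemma inv_one_sub_killed_mulVec_one (hT : T ∈ rowStochastic ℝ α) {x : α}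
    (hreach : ∀ a, Relation.ReflTransGen (fun i j => 0 < T i j) a x) {ω : ℝ} (hω₀ : 0 < ω)
    (hω₁ : ω < 1) :
    (1 - diagonal (Function.update 1 x (1 - ω)) * T)⁻¹ *ᵥ 1 =
      Function.update (meanHitTime T x) x 0 +
        Function.const α (1 + (1 - ω) / ω * meanHitTime T x x) := by
  set h := meanHitTime T x with hh
  set c := 1 + (1 - ω) / ω * h x with hc
  set d : α → ℝ := Function.update 1 x (1 - ω) with hd
  have hd_bounds : ∀ a, 0 < d a ∧ d a ≤ 1 := by
    intro a
    rcases eq_or_ne a x with rfl | hax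
    · simp [hd, hω₀.le, hω₁]
    · simp [hd, hax]
  have hleak : ∀ a, ∃ b, Relation.ReflTransGen (fun i j => 0 < d i * T i j) a b ∧ d b < 1 :=
    fun a => ⟨x, (hreach a).lift id fun i _ => mul_pos (hd_bounds i).1, by simp [hd, hω₀]⟩
  have htransient := isTransient_diagonal_mul hT (fun a => (hd_bounds a).1.le)
    (fun a => (hd_bounds a).2) hleak
  have hstep : T *ᵥ Function.update h x 0 = h - 1 := by
    rw [← tabooMatrix_mulVec, eq_sub_iff_add_eq', eq_comm,
      ← (isTransient_tabooMatrix hT hreach).inv_one_sub_mulVec_eq_iff, hh, meanHitTime]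
  have hconst : T *ᵥ Function.const α c = Function.const α c := by
    rw [show Function.const α c = c • (1 : α → ℝ) by ext; simp, mulVec_smul,
      one_vecMul_of_mem_rowStochastic hT]
  rw [htransient.inv_one_sub_mulVec_eq_iff, ← mulVec_mulVec, mulVec_add, hstep, hconst]
  ext a
  simp only [Pi.add_apply, Pi.sub_apply, Pi.one_apply, Function.const_apply, mulVec_diagonal]
  rcases eq_or_ne a x with rfl | hax
  · simp only [hd, hc, Function.update_self]
    field_simp
    ring
  · simp only [hd, Function.update_of_ne hax, Pi.one_apply]
    ring

end RowStochastic

lemma lt_hitTime_iff {α : Type*} {x : α} {y : ℕ → α} {t : ℕ} :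
    (t : ℕ∞) < hitTime x y ↔ ∀ s < t, y (s + 1) ≠ x := by
  simp only [← ENat.add_one_le_iff (ENat.natCast_ne_top t), hitTime, le_iInf_iff, Set.mem_ofPred_eq]
  norm_cast
  constructor
  · intro hle s hst hs
    have := hle (s + 1) ⟨s.succ_pos, hs⟩
    lia
  · rintro havoid (_ | s) ⟨hpos, hs⟩
    · exact absurd hpos (lt_irrefl 0)
    · by_contra! hlt
      exact havoid s (by lia) hs

lemma enat_toENNReal_eq_tsum (e : ℕ∞) : (e : ℝ≥0∞) = ∑' t : ℕ, if (t : ℕ∞) < e then 1 else 0 := by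
  induction e using ENat.recTopCoe with
  | top => simp
  | coe k =>
    simp only [Nat.cast_lt, ENat.toENNReal_coe]
    rw [tsum_eq_sum (s := Finset.range k) fun t ht => if_neg (by simpa using ht),
      Finset.sum_congr rfl fun t ht => if_pos (Finset.mem_range.1 ht)]
    simp

lemma lintegral_enat_eq_tsum {Ω : Type*} [MeasurableSpace Ω] {μ : Measure Ω} {τ : Ω → ℕ∞}
    (hτ : ∀ t : ℕ, MeasurableSet {y | (t : ℕ∞) < τ y}) :
    ∫⁻ y, (τ y : ℝ≥0∞) ∂μ = ∑' t : ℕ, μ {y | (t : ℕ∞) < τ y} := by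
  have hind : ∀ y, (τ y : ℝ≥0∞) = ∑' t : ℕ, {y | (t : ℕ∞) < τ y}.indicator 1 y := fun y => by
    simp only [enat_toENNReal_eq_tsum, Set.indicator_apply, Set.mem_ofPred_eq, Pi.one_apply]
  simp_rw [hind]
  rw [lintegral_tsum fun t => (measurable_one.indicator (hτ t)).aemeasurable]
  exact tsum_congr fun t => lintegral_indicator_one (hτ t)

section Chain

variable {α : Type*} [Fintype α] [DecidableEq α] [MeasurableSpace α] [MeasurableSingletonClass α]

instance isProbabilityMeasure_chainLaw (T : rowStochastic ℝ α) (ν : Measure α)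
    [IsProbabilityMeasure ν] : IsProbabilityMeasure (chainLaw T ν) := by
  unfold chainLaw
  infer_instance

lemma map_eval_zero_chainLaw (T : rowStochastic ℝ α) (ν : Measure α) [IsProbabilityMeasure ν] :
    (chainLaw T ν).map (fun y => y 0) = ν := by
  have hpast : (chainLaw T ν).map (Preorder.frestrictLe (π := fun _ => α) 0) =
      ν.map (MeasurableEquiv.piUnique fun _ : Finset.Iic 0 => α).symm := by
    rw [chainLaw, Kernel.trajMeasure, Measure.map_comp _ _ (by fun_prop),
      Kernel.traj_map_frestrictLe, Kernel.partialTraj_self, Measure.id_comp]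
  have heval : (fun y : ℕ → α => y 0) =
      (MeasurableEquiv.piUnique fun _ : Finset.Iic 0 => α) ∘
        Preorder.frestrictLe (π := fun _ => α) 0 := rfl
  rw [heval, ← Measure.map_map (MeasurableEquiv.measurable _) (by fun_prop), hpast,
    MeasurableEquiv.map_map_symm]

lemma stepKernel_singleton (T : rowStochastic ℝ α) (a b : α) :
    stepKernel T a {b} = ENNReal.ofReal (T.1 a b) :=
  PMF.toMeasure_apply_singleton _ _ (measurableSet_singleton b)

lemma setLIntegral_compl_stepKernel (T : rowStochastic ℝ α) (x a : α) {f : α → ℝ} (hf : 0 ≤ f) :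
    ∫⁻ b in {x}ᶜ, ENNReal.ofReal (f b) ∂stepKernel T a =
      ENNReal.ofReal ((tabooMatrix T.1 x *ᵥ f) a) := by
  have hterm : ∀ b, 0 ≤ T.1 a b * Function.update f x 0 b := fun b =>
    mul_nonneg (T.2.1 a b) (by rw [Function.update_apply]; split_ifs; exacts [le_rfl, hf b])
  rw [← lintegral_indicator (measurableSet_singleton x).compl, lintegral_fintype,
    tabooMatrix_mulVec, mulVec, dotProduct, ENNReal.ofReal_sum_of_nonneg fun b _ => hterm b]
  refine Finset.sum_congr rfl fun b _ => ?_
  rw [stepKernel_singleton, ENNReal.ofReal_mul (T.2.1 a b), mul_comm]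
  rcases eq_or_ne b x with rfl | hbx
  · simp
  · simp [hbx]

lemma setLIntegral_chainLaw_markov (T : rowStochastic ℝ α) (ν : Measure α) [IsProbabilityMeasure ν]
    (t : ℕ) (s : Set (Finset.Iic t → α)) (C : Set α) (f : α → ℝ≥0∞) :
    ∫⁻ y in {y | Preorder.frestrictLe (π := fun _ => α) t y ∈ s ∧ y (t + 1) ∈ C}, f (y (t + 1))
        ∂chainLaw T ν =
      ∫⁻ y in {y | Preorder.frestrictLe (π := fun _ => α) t y ∈ s}, ∫⁻ b in C, f b
        ∂stepKernel T (y t) ∂chainLaw T ν := by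
  have hs : MeasurableSet s := s.toFinite.measurableSet
  have hC : MeasurableSet C := C.toFinite.measurableSet
  have hf : Measurable f := measurable_of_finite f
  have hjoint := Kernel.map_frestrictLe_trajMeasure_compProd_eq_map_trajMeasure
    (X := fun _ => α) (μ₀ := ν) (κ := historyKernel T) (a := t)
  calc _ = ∫⁻ p in s ×ˢ C, f p.2 ∂(chainLaw T ν).map
          fun y => (Preorder.frestrictLe (π := fun _ => α) t y, y (t + 1)) :=
        (setLIntegral_map (hs.prod hC) (by fun_prop) (by fun_prop)).symm
    _ = ∫⁻ p in s, ∫⁻ b in C, f b ∂historyKernel T t p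
          ∂(chainLaw T ν).map (Preorder.frestrictLe (π := fun _ => α) t) := by
        rw [chainLaw, ← hjoint, Measure.setLIntegral_compProd (by fun_prop) hs hC]
    _ = _ := setLIntegral_map hs (measurable_of_finite _) (by fun_prop)

lemma setLIntegral_avoid_chainLaw (T : rowStochastic ℝ α) (ν : Measure α)
    [IsProbabilityMeasure ν] (x : α) (B : Set α) (t : ℕ) {f : α → ℝ} (hf : 0 ≤ f) :
    ∫⁻ y in {y | y 0 ∈ B ∧ ∀ s < t, y (s + 1) ≠ x}, ENNReal.ofReal (f (y t)) ∂chainLaw T ν =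
      ∫⁻ a in B, ENNReal.ofReal ((tabooMatrix T.1 x ^ t *ᵥ f) a) ∂ν := by
  induction t generalizing f with
  | zero =>
    simp only [pow_zero, one_mulVec, not_lt_zero, IsEmpty.forall_iff, implies_true, and_true]
    conv_rhs => rw [← map_eval_zero_chainLaw T ν]
    rw [setLIntegral_map B.toFinite.measurableSet (measurable_of_finite _) (by fun_prop)]
    rfl
  | succ t ih =>
    have htaboo : 0 ≤ tabooMatrix T.1 x *ᵥ f := fun a =>
      Finset.sum_nonneg fun b _ => mul_nonneg (tabooMatrix_nonneg T.2 x a b) (hf b)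
    rw [pow_succ, ← mulVec_mulVec, ← ih htaboo]
    have hmarkov := setLIntegral_chainLaw_markov T ν t
      {p | p ⟨0, by simp⟩ ∈ B ∧ ∀ s : Fin t, p ⟨s + 1, Finset.mem_Iic.2 s.2⟩ ≠ x}
      {x}ᶜ fun a => ENNReal.ofReal (f a)
    simp only [setLIntegral_compl_stepKernel T x _ hf, Set.mem_ofPred_eq,
      Preorder.frestrictLe_apply, Set.mem_compl_iff, Set.mem_singleton_iff, and_assoc,
      Fin.forall_iff] at hmarkov
    simpa only [Nat.forall_lt_succ_right] using hmarkov

lemma lintegral_hitTime_chainLaw_dirac (T : rowStochastic ℝ α) (x a : α) :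
    ∫⁻ y, (hitTime x y : ℝ≥0∞) ∂chainLaw T (Measure.dirac a) =
      ∑' t, ENNReal.ofReal ((tabooMatrix T.1 x ^ t *ᵥ 1) a) := by
  rw [lintegral_enat_eq_tsum]
  · refine tsum_congr fun t => ?_
    have havoid := setLIntegral_avoid_chainLaw T (Measure.dirac a) x Set.univ t zero_le_one
    simpa [lt_hitTime_iff] using havoid
  · intro t
    simp only [lt_hitTime_iff]
    measurability

lemma tendsto_setLIntegral_tabooMatrix_pow (T : rowStochastic ℝ α) (ν : Measure α)
    [IsProbabilityMeasure ν] (x : α) :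
    Tendsto (fun t => ∫⁻ a in {x}ᶜ, ENNReal.ofReal ((tabooMatrix T.1 x ^ t *ᵥ 1) a) ∂ν) atTop
      (𝓝 (1 - chainLaw T ν {y | ∃ t, y t = x})) := by
  have hsurvive : ∀ t, ∫⁻ a in {x}ᶜ, ENNReal.ofReal ((tabooMatrix T.1 x ^ t *ᵥ 1) a) ∂ν =
      chainLaw T ν {y | y 0 ≠ x ∧ ∀ s < t, y (s + 1) ≠ x} := fun t => by
    simpa using (setLIntegral_avoid_chainLaw T ν x {x}ᶜ t zero_le_one).symm
  have hnever : {y : ℕ → α | ∃ t, y t = x}ᶜ =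
      ⋂ t : ℕ, {y | y 0 ≠ x ∧ ∀ s < t, y (s + 1) ≠ x} := by
    ext y
    simp only [Set.mem_compl_iff, Set.mem_ofPred_eq, not_exists, Set.mem_iInter]
    refine ⟨fun h t => ⟨h 0, fun s _ => h (s + 1)⟩, fun h => ?_⟩
    rintro (_ | t)
    exacts [(h 0).1, (h (t + 1)).2 t t.lt_succ_self]
  have hmeas : MeasurableSet {y : ℕ → α | ∃ t, y t = x} := by measurability
  simp only [hsurvive]
  rw [← prob_compl_eq_one_sub hmeas, hnever]
  refine tendsto_measure_iInter_atTop (fun t => ?_) ?_ ⟨0, measure_ne_top _ _⟩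
  · exact MeasurableSet.nullMeasurableSet (by measurability)
  · exact fun t t' htt' y hy => ⟨hy.1, fun s hs => hy.2 s (hs.trans_le htt')⟩

end Chain

section FromBlocks

variable {α β : Type*} [DecidableEq α] [DecidableEq β]

lemma tabooMatrix_fromBlocks_inl (A : Matrix α α ℝ) (B : Matrix α β ℝ) (C : Matrix β α ℝ)
    (D : Matrix β β ℝ) (x : α) :
    tabooMatrix (fromBlocks A B C D) (Sum.inl x) =
      fromBlocks (tabooMatrix A x) B (C.updateCol x 0) D := by
  ext (i | i) (j | j) <;> simp [tabooMatrix, updateCol_apply]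

variable [Fintype α] [Fintype β]

lemma fromBlocks_zero_one_pow_mulVec (A : Matrix α α ℝ) (B : Matrix α β ℝ) (u : α → ℝ)
    (v : β → ℝ) (t : ℕ) :
    fromBlocks A B 0 1 ^ t *ᵥ Sum.elim u v =
      Sum.elim (A ^ t *ᵥ u + ∑ s ∈ Finset.range t, A ^ s *ᵥ (B *ᵥ v)) v := by
  induction t generalizing u with
  | zero => simp
  | succ t ih =>
    rw [pow_succ, ← mulVec_mulVec, fromBlocks_mulVec]
    simp only [Sum.elim_comp_inl, Sum.elim_comp_inr, zero_mulVec, one_mulVec, zero_add]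
    rw [ih, mulVec_add, mulVec_mulVec, ← pow_succ, Finset.sum_range_succ, add_assoc, add_comm]
    congr 1
    abel

lemma tendsto_fromBlocks_zero_one_pow_mulVec {A : Matrix α α ℝ} (hA : IsTransient A)
    (B : Matrix α β ℝ) (u : α → ℝ) (v : β → ℝ) :
    Tendsto (fun t => fromBlocks A B 0 1 ^ t *ᵥ Sum.elim u v) atTop
      (𝓝 (Sum.elim ((1 - A)⁻¹ *ᵥ (B *ᵥ v)) v)) := by
  simp only [fromBlocks_zero_one_pow_mulVec]
  have htransient := (hA.hasSum_pow_mulVec u).summable.tendsto_atTop_zero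
  have habsorbed := (hA.hasSum_pow_mulVec (B *ᵥ v)).tendsto_sum_nat
  have hlimit := htransient.add habsorbed
  rw [zero_add] at hlimit
  refine tendsto_pi_nhds.2 ?_
  rintro (i | i)
  · exact tendsto_pi_nhds.1 hlimit i
  · exact tendsto_const_nhds

end FromBlocks

section Model

variable {n : ℕ}

lemma reflTransGen_of_stronglyConnected {W : rowStochastic ℝ (Fin n)} (hconn : StronglyConnected W)
    (i j : Fin n) : Relation.ReflTransGen (fun k l => 0 < W.1 k l) i j :=
  Relation.reflTransGen_swap.1 (hconn j i)

lemma expHitTime_eq_ofReal {W : rowStochastic ℝ (Fin n)} (hconn : StronglyConnected W)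
    (j i : Fin n) : expHitTime W j i = ENNReal.ofReal (meanHitTime W.1 i j) := by
  have htransient := isTransient_tabooMatrix W.2 fun k =>
    reflTransGen_of_stronglyConnected hconn k i
  have haug : (augTransition W fun _ => 0).1 = fromBlocks W.1 0 0 1 := by
    simp [augTransition, augMatrix, stubMatrix]
  have hpow : ∀ t, (tabooMatrix (augTransition W fun _ => 0).1 (Sum.inl i) ^ t *ᵥ 1) (Sum.inl j) =
      (tabooMatrix W.1 i ^ t *ᵥ 1) j := fun t => by
    have hC : (0 : Matrix (Fin n) (Fin n) ℝ).updateCol i 0 = 0 := by ext; simp [updateCol_apply]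
    rw [haug, tabooMatrix_fromBlocks_inl, hC, ← Sum.elim_one_one, fromBlocks_zero_one_pow_mulVec]
    simp
  have hsum : HasSum (fun t => (tabooMatrix W.1 i ^ t *ᵥ 1) j) (meanHitTime W.1 i j) :=
    Pi.hasSum.1 (htransient.hasSum_pow_mulVec 1) j
  rw [expHitTime, lintegral_hitTime_chainLaw_dirac, ← hsum.tsum_eq, ENNReal.ofReal_tsum_of_nonneg
    (fun t => htransient.pow_mulVec_nonneg zero_le_one t j) hsum.summable]
  simp only [hpow]

/-- The probability that the agent `i`, with stubbornness `θ` and linked to the influencer iff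
`i ∈ S`, hands the walk of the augmented chain over to an agent rather than to an absorbing
state. -/
def survivalProb (S : Finset (Fin n)) (θ ω : ℝ) (i : Fin n) : ℝ :=
  (1 - θ) * (1 - ω * indVec S i)

lemma objF_eq_sum (W : rowStochastic ℝ (Fin n)) (S : Finset (Fin n)) (θ ω : ℝ) :
    objF W S θ ω =
      (1 / n : ℝ) * ∑ i, ((1 - diagonal (survivalProb S θ ω) * W.1)⁻¹ *ᵥ 1) i := by
  have hmatrix : (1 - θ) • ((1 - ω • diagonal (indVec S)) * W.1) =
      diagonal (survivalProb S θ ω) * W.1 := by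
    rw [← smul_mul_assoc]
    congr 1
    ext i j
    rcases eq_or_ne i j with rfl | hij <;> simp [survivalProb, *]
  rw [objF, hmatrix, one_dotProduct]

lemma HMatrix_const (W : rowStochastic ℝ (Fin n)) (θ ω : I) (S : Finset (Fin n)) :
    HMatrix W (fun _ => θ) ω S = diagonal (survivalProb S θ ω) * W.1 := by
  ext i j
  rw [HMatrix_apply, diagonal_mul, survivalProb]
  ring

lemma one_add_hitCost {W : rowStochastic ℝ (Fin n)} (hconn : StronglyConnected W) {ω : ℝ}
    (hω₀ : 0 < ω) (hω₁ : ω < 1) (i : Fin n) :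
    1 + hitCost W ω i = ENNReal.ofReal (objF W {i} 0 ω) := by
  set h := meanHitTime W.1 i with hh
  have hreach := fun k => reflTransGen_of_stronglyConnected hconn k i
  have hnonneg : 0 ≤ h :=
    (isTransient_tabooMatrix W.2 hreach).inv_one_sub_mulVec_nonneg zero_le_one
  have hn : (0 : ℝ) < n := Nat.cast_pos.2 i.pos
  have hratio : 0 ≤ (1 - ω) / ω := div_nonneg (sub_nonneg.2 hω₁.le) hω₀.le
  have hsurvival : survivalProb {i} 0 ω = Function.update (1 : Fin n → ℝ) i (1 - ω) := by
    ext j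
    rcases eq_or_ne j i with rfl | hji <;> simp [survivalProb, indVec, *]
  have hobj : objF W {i} 0 ω =
      1 + ((n : ℝ)⁻¹ * ∑ j ∈ Finset.univ.erase i, h j + (1 - ω) / ω * h i) := by
    rw [objF_eq_sum, hsurvival, inv_one_sub_killed_mulVec_one W.2 hreach hω₀ hω₁, ← hh]
    simp only [Pi.add_apply, Function.const_apply, Finset.sum_add_distrib,
      Finset.sum_update_of_mem (Finset.mem_univ i), Finset.sdiff_singleton_eq_erase,
      Finset.sum_const, Finset.card_univ, Fintype.card_fin, nsmul_eq_mul]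
    field_simp
    ring
  have hsum : 0 ≤ ∑ j ∈ Finset.univ.erase i, h j := Finset.sum_nonneg fun j _ => hnonneg j
  have hterm : 0 ≤ (1 - ω) / ω * h i := mul_nonneg hratio (hnonneg i)
  rw [hobj, ENNReal.ofReal_add zero_le_one (by positivity), ENNReal.ofReal_one,
    ENNReal.ofReal_add (by positivity) hterm, ENNReal.ofReal_mul (by positivity),
    ENNReal.ofReal_sum_of_nonneg fun j _ => hnonneg j, ENNReal.ofReal_mul hratio,
    ENNReal.ofReal_inv_of_pos hn, ENNReal.ofReal_natCast, hitCost]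
  simp only [expHitTime_eq_ofReal hconn, ← hh]

lemma hitCost_le_iff {W : rowStochastic ℝ (Fin n)} (hconn : StronglyConnected W) {ω : ℝ}
    (hω₀ : 0 < ω) (hω₁ : ω < 1) (i k : Fin n) :
    hitCost W ω i ≤ hitCost W ω k ↔ objF W {i} 0 ω ≤ objF W {k} 0 ω := by
  have hpos : 0 < objF W {k} 0 ω := by
    rw [← ENNReal.ofReal_pos, ← one_add_hitCost hconn hω₀ hω₁]
    positivity
  rw [← ENNReal.add_le_add_iff_left ENNReal.one_ne_top, one_add_hitCost hconn hω₀ hω₁,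
    one_add_hitCost hconn hω₀ hω₁, ENNReal.ofReal_le_ofReal_iff hpos.le]

lemma forall_hitCost_le_iff {W : rowStochastic ℝ (Fin n)} (hconn : StronglyConnected W) {ω : ℝ}
    (hω₀ : 0 < ω) (hω₁ : ω < 1) {i₀ : Fin n}
    (hi₀ : ∀ j, j ≠ i₀ → objF W {i₀} 0 ω < objF W {j} 0 ω) (i : Fin n) :
    (∀ k, hitCost W ω i ≤ hitCost W ω k) ↔ i = i₀ := by
  simp only [hitCost_le_iff hconn hω₀ hω₁]
  constructor
  · intro hmin
    by_contra hne
    exact (hmin i₀).not_gt (hi₀ i hne)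
  · rintro rfl k
    rcases eq_or_ne k i with rfl | hne
    exacts [le_rfl, (hi₀ k hne).le]

instance isProbabilityMeasure_initLaw (n : ℕ) : IsProbabilityMeasure (initLaw n) where
  measure_univ := by
    simp only [initLaw, Measure.smul_apply, Measure.add_apply, Measure.finsetSum_apply,
      measure_univ, Finset.sum_const, Finset.card_univ, Fintype.card_fin, nsmul_eq_mul, mul_one,
      smul_eq_mul]
    rw [add_comm 1]
    exact ENNReal.inv_mul_cancel (by simp) (by finiteness)

lemma setLIntegral_compl_initLaw (f : InflState n → ℝ≥0∞) :
    ∫⁻ a in {Sum.inl ()}ᶜ, f a ∂initLaw n =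
      ((n : ℝ≥0∞) + 1)⁻¹ * ∑ i : Fin n, f (Sum.inr (Sum.inl i)) := by
  rw [← lintegral_indicator (measurableSet_singleton _).compl, initLaw, lintegral_smul_measure,
    lintegral_add_measure, lintegral_finsetSum_measure]
  simp only [lintegral_dirac]
  simp

lemma tabooMatrix_inflMatrix (W : rowStochastic ℝ (Fin n)) (θ : Fin n → I) (ω : I)
    (S : Finset (Fin n)) :
    tabooMatrix (inflMatrix W θ ω S) (Sum.inl ()) =
      fromBlocks 0 0 0 (fromBlocks (HMatrix W θ ω S) (stubMatrix θ) 0 1) := by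
  rw [inflMatrix, tabooMatrix_fromBlocks_inl]
  rfl

lemma one_sub_absorbProb (W : rowStochastic ℝ (Fin n)) (θ : Fin n → I) (ω : I)
    (S : Finset (Fin n)) (hH : IsTransient (HMatrix W θ ω S)) :
    1 - absorbProb W θ ω S = ((n : ℝ≥0∞) + 1)⁻¹ *
      ∑ i, ENNReal.ofReal (((1 - HMatrix W θ ω S)⁻¹ *ᵥ (stubMatrix θ *ᵥ 1)) i) := by
  set D : Matrix (Fin n ⊕ Fin n) (Fin n ⊕ Fin n) ℝ :=
    fromBlocks (HMatrix W θ ω S) (stubMatrix θ) 0 1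
  have hpow : ∀ t i, (tabooMatrix (inflTransition W θ ω S).1 (Sum.inl ()) ^ t *ᵥ 1)
      (Sum.inr (Sum.inl i)) = (D ^ t *ᵥ 1) (Sum.inl i) := fun t i => by
    rw [inflTransition, tabooMatrix_inflMatrix, fromBlocks_diagonal_pow,
      ← Sum.elim_one_one, fromBlocks_mulVec]
    simp [D]
  have hsurvive : ∀ i, Tendsto (fun t => (D ^ t *ᵥ 1) (Sum.inl i)) atTop
      (𝓝 (((1 - HMatrix W θ ω S)⁻¹ *ᵥ (stubMatrix θ *ᵥ 1)) i)) := fun i => by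
    rw [← Sum.elim_one_one]
    exact tendsto_pi_nhds.1 (tendsto_fromBlocks_zero_one_pow_mulVec hH (stubMatrix θ) 1 1) _
  refine tendsto_nhds_unique (tendsto_setLIntegral_tabooMatrix_pow _ (initLaw n) _) ?_
  simp only [setLIntegral_compl_initLaw, hpow]
  exact ENNReal.Tendsto.const_mul (tendsto_finsetSum _ fun i _ =>
    ENNReal.tendsto_ofReal (hsurvive i)) (.inr (by simp))

lemma isTransient_survivalProb_mul (W : rowStochastic ℝ (Fin n)) (S : Finset (Fin n)) {θ ω : ℝ}
    (hθ₀ : 0 < θ) (hθ₁ : θ ≤ 1) (hω₀ : 0 ≤ ω) (hω₁ : ω ≤ 1) :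
    IsTransient (diagonal (survivalProb S θ ω) * W.1) := by
  have hlink : ∀ i, 0 ≤ 1 - ω * indVec S i ∧ 1 - ω * indVec S i ≤ 1 := fun i =>
    ⟨sub_nonneg.2 (mul_le_one₀ hω₁ (indVec_mem S i).1 (indVec_mem S i).2),
      sub_le_self _ (mul_nonneg hω₀ (indVec_mem S i).1)⟩
  have hlt : ∀ i, survivalProb S θ ω i < 1 := fun i =>
    (mul_le_of_le_one_right (sub_nonneg.2 hθ₁) (hlink i).2).trans_lt (sub_lt_self _ hθ₀)
  exact isTransient_diagonal_mul W.2 (fun i => mul_nonneg (sub_nonneg.2 hθ₁) (hlink i).1)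
    (fun i => (hlt i).le) fun i => ⟨i, .refl, hlt i⟩

lemma absorbProb_le_iff [NeZero n] (W : rowStochastic ℝ (Fin n)) {θ ω : I} (hθ : 0 < θ)
    (S S' : Finset (Fin n)) :
    absorbProb W (fun _ => θ) ω S' ≤ absorbProb W (fun _ => θ) ω S ↔
      objF W S θ ω ≤ objF W S' θ ω := by
  have hθ' : (0 : ℝ) < θ := hθ
  have hn : (0 : ℝ) < 1 / n := one_div_pos.2 (Nat.cast_pos.2 (NeZero.pos n))
  have htransient := fun S => isTransient_survivalProb_mul W S hθ' θ.2.2 ω.2.1 ω.2.2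
  have hnonneg := fun S => (htransient S).inv_one_sub_mulVec_nonneg zero_le_one
  have hstub : stubMatrix (fun _ => θ) *ᵥ 1 = (θ : ℝ) • (1 : Fin n → ℝ) := by
    ext
    simp [stubMatrix, mulVec_diagonal]
  have habsorb : ∀ S, 1 - absorbProb W (fun _ => θ) ω S = ((n : ℝ≥0∞) + 1)⁻¹ *
      ENNReal.ofReal (θ * ∑ i, ((1 - diagonal (survivalProb S θ ω) * W.1)⁻¹ *ᵥ 1) i) := fun S => by
    rw [one_sub_absorbProb _ _ _ _ (HMatrix_const W θ ω S ▸ htransient S), HMatrix_const, hstub,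
      mulVec_smul, Finset.mul_sum _ _ (θ : ℝ),
      ENNReal.ofReal_sum_of_nonneg fun i _ => mul_nonneg hθ'.le (hnonneg S i)]
    rfl
  have hle_one : absorbProb W (fun _ => θ) ω S' ≤ 1 := prob_le_one
  have hsum_nonneg : 0 ≤ ∑ i, ((1 - diagonal (survivalProb S' θ ω) * W.1)⁻¹ *ᵥ 1) i :=
    Finset.sum_nonneg fun i _ => hnonneg S' i
  rw [← ENNReal.sub_le_sub_iff_left hle_one ENNReal.one_ne_top, habsorb, habsorb,
    ENNReal.mul_le_mul_iff_right (by simp) (by finiteness),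
    ENNReal.ofReal_le_ofReal_iff (by positivity), mul_le_mul_iff_right₀ hθ', objF_eq_sum,
    objF_eq_sum, mul_le_mul_iff_right₀ hn]

lemma objF_lt_of_ssubset (W : rowStochastic ℝ (Fin n)) {S S' : Finset (Fin n)} (hS : S ⊂ S')
    {θ ω : ℝ} (hθ₀ : 0 < θ) (hθ₁ : θ < 1) (hω₀ : 0 < ω) (hω₁ : ω ≤ 1) :
    objF W S' θ ω < objF W S θ ω := by
  obtain ⟨k, hkS', hkS⟩ := Finset.exists_of_ssubset hS
  have hn : (0 : ℝ) < 1 / n := one_div_pos.2 (Nat.cast_pos.2 k.pos)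
  have hind : ∀ i, indVec S i ≤ indVec S' i := fun i => by
    by_cases hi : i ∈ S
    · simp [indVec, hi, hS.subset hi]
    · simpa [indVec, hi] using (indVec_mem S' i).1
  have hentry : ∀ i j, (diagonal (survivalProb S' θ ω) * W.1) i j ≤
      (diagonal (survivalProb S θ ω) * W.1) i j := fun i j => by
    have hlink := sub_le_sub_left (mul_le_mul_of_nonneg_left (hind i) hω₀.le) 1
    rw [diagonal_mul, diagonal_mul]
    exact mul_le_mul_of_nonneg_right (mul_le_mul_of_nonneg_left hlink (sub_nonneg.2 hθ₁.le))
      (W.2.1 i j)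
  have hrow : ((diagonal (survivalProb S' θ ω) * W.1) *ᵥ 1) k <
      ((diagonal (survivalProb S θ ω) * W.1) *ᵥ 1) k := by
    rw [diagonal_mul_mulVec_one W.2, diagonal_mul_mulVec_one W.2]
    simp only [survivalProb, indVec, hkS, hkS', if_true, if_false, mul_one, mul_zero, sub_zero]
    exact mul_lt_of_lt_one_right (sub_pos.2 hθ₁) (sub_lt_self 1 hω₀)
  rw [objF_eq_sum, objF_eq_sum, mul_lt_mul_iff_right₀ hn]
  exact (isTransient_survivalProb_mul W S' hθ₀ hθ₁.le hω₀.le hω₁).sum_inv_one_sub_mulVec_one_lt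
    (isTransient_survivalProb_mul W S hθ₀ hθ₁.le hω₀.le hω₁) hentry hrow

lemma isOptimalSet_one_iff (W : rowStochastic ℝ (Fin n)) {θ ω : I} (hθ₀ : 0 < θ) (hθ₁ : θ < 1)
    (hω : 0 < ω) {i : Fin n} (hi : ∀ j, j ≠ i → objF W {i} θ ω < objF W {j} θ ω)
    (S : Finset (Fin n)) : IsOptimalSet W (fun _ => θ) ω 1 S ↔ S = {i} := by
  have : NeZero n := ⟨i.pos.ne'⟩
  have hempty : objF W {i} θ ω < objF W ∅ θ ω :=
    objF_lt_of_ssubset W (Finset.singleton_nonempty i).empty_ssubset hθ₀ hθ₁ hω ω.2.2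
  have hunique : ∀ S' : Finset (Fin n), S'.card ≤ 1 → S' ≠ {i} →
      objF W {i} θ ω < objF W S' θ ω := by
    intro S' hcard hne
    rcases Nat.le_one_iff_eq_zero_or_eq_one.1 hcard with hzero | hone
    · rwa [Finset.card_eq_zero.1 hzero]
    · obtain ⟨j, rfl⟩ := Finset.card_eq_one.1 hone
      exact hi j fun hji => hne (congrArg _ hji)
  simp only [IsOptimalSet, absorbProb_le_iff W hθ₀]
  constructor
  · rintro ⟨hcard, hmin⟩
    by_contra hne
    exact (hmin {i} (Finset.card_singleton i).le).not_gt (hunique S hcard hne)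
  · rintro rfl
    refine ⟨(Finset.card_singleton i).le, fun S' hcard => ?_⟩
    rcases eq_or_ne S' {i} with rfl | hne
    exacts [le_rfl, (hunique S' hcard hne).le]

end Model

end SocialPower

end

open SocialPower in
/-- Homogeneous stubbornness `θ` and budget `K = 1`: maximizing the absorption probability `π₀(S)`
over `|S| ≤ 1` is equivalent to minimizing the hitting-time cost over single agents. -/
theorem proposition3 {n : ℕ} (W : Matrix.rowStochastic ℝ (Fin n)) (θ ω : unitInterval)
    (hθ : 0 < θ ∧ θ < 1) (hω : 0 < ω ∧ ω < 1)
    (hconn : StronglyConnected W)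
    (hsmall : SmallStubbornness W θ ω) :
    (∀ j i : Fin n, expHitTime W j i < ⊤) ∧
      ∀ S : Finset (Fin n),
        IsOptimalSet W (fun _ => θ) ω 1 S ↔
          ∃ i : Fin n, S = {i} ∧ ∀ k : Fin n, hitCost W ω i ≤ hitCost W ω k := by
  have hω₀ : (0 : ℝ) < ω := hω.1
  have hω₁ : (ω : ℝ) < 1 := hω.2
  obtain ⟨i₀, hmin_zero, hmin_θ⟩ := hsmall
  refine ⟨fun j i => ?_, fun S => ?_⟩
  · rw [expHitTime_eq_ofReal hconn]
    exact ENNReal.ofReal_lt_top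
  · rw [isOptimalSet_one_iff W hθ.1 hθ.2 hω.1 fun j hj => sub_pos.1 (hmin_θ j hj)]
    simp only [forall_hitCost_le_iff hconn hω₀ hω₁ hmin_zero, exists_eq_right]
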